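/- Hidden bandit model with parameter $p\in(0,1)$ and $T$ rounds. There are two arms, the reference arm $0$ and the decoy arm $1$. Before round $1$ the player is placed on arm $0$ with probability $\frac{p}{1+p}$ and on arm $1$ with probability $\frac{1}{1+p}$. On each round $t=1,\dots,T$ the player chooses either "stay" (he remains on the arm on which he entered the round) or "switch" (from arm $0$ he moves to arm $1$; from arm $1$ he moves to arm $0$ with probability $p$ and remains on arm $1$ with probability $1-p$, independently of everything else); he then pulls the resulting arm $X_t\in\{0,1\}$ and observes only the reward $r_t(X_t)\in[0,1]$, not the arm $X_t$. A deterministic player chooses his action on round $t$ as a function of the rewards observed on rounds $1,\dots,t-1$; a randomized player is a random deterministic player, whose internal randomness is independent of the initial arm and of the switches. A reward sequence $r_1,\dots,r_T:\{0,1\}\to[0,1]$ is oblivious if it is fixed before the game begins (on both arms). The expected regret on $r_{1:T}$ is $$\sum_{t=1}^T r_t(0)-\mathbf{E}\Big[\sum_{t=1}^T r_t(X_t)\Big].$$ Theorem. Let $p=\frac12$. (1) There is a universal constant $c>0$ such that for every $T\ge 2$ and every randomized player there is an oblivious reward sequence $r_1,\dots,r_T:\{0,1\}\to[0,1]$, which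 may depend on the player, on which the expected regret of the player is at least $c\,T/\log_2^{3/2}T$. (2) Let $T\ge2$, $\epsilon=\frac{1}{320\log_2^{3/2}T}$ and $\gamma=\frac1{4\log_2T}$. Let $\xi_1,\dots,\xi_T$ be i.i.d. random variables, independent of the initial arm and of the switches, with $$\Pr(\xi_t=\epsilon n)=\tfrac{1-e^{-\gamma}}{1+e^{-\gamma}}\,e^{-\gamma|n|}\qquad(n\in\mathbb{Z}).$$ Let $W_0=0$ and $W_t=W_{\rho(t)}+\xi_t$ for $1\le t\le T$, where $\rho(t)=t-2^{\delta(t)}$ and $\delta(t)=\max\{i\ge0: 2^i\text{ divides }t\}$. Let $\Gamma_t(x)=\min\{\max\{\frac12+W_t-\epsilon\mathbf{1}\{x\neq0\},0\},1\}$ for $x\in\{0,1\}$. Then for every deterministic player the expected regret on the random reward sequence $\Gamma_1,\dots,\Gamma_T$, with the expectation taken over $\Gamma_{1:T}$ as well, is at least $10^{-4}\,T/\log_2^{3/2}T$. -/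

import Mathlib

open MeasureTheory

namespace HiddenBandit

/-- The two arms: arm `0` is the reference arm, arm `1` is the decoy arm. -/
inductive Arm
  | reference
  | decoy
  deriving DecidableEq

instance : Fintype Arm := ⟨{.reference, .decoy}, fun i => by cases i <;> simp⟩

/-- The two actions available to the player on each round. -/
inductive Move
  | stay
  | switch
  deriving DecidableEq

/-- A deterministic player for `T` rounds. Rounds are numbered from `0`, so that on round `t` the
player has observed `t` rewards (on rounds `0, …, t - 1`); he chooses his action on round `t` as
a function of these rewards only. He does not observe the arms. -/
abbrev Player (T : ℕ) : Type := (t : Fin T) → (Fin t.val → ℝ) → Move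

/-- The distribution of the initial arm, before the first round. -/
noncomputable def initProb (p : ℝ) : Arm → ℝ
  | .reference => p / (1 + p)
  | .decoy => 1 / (1 + p)

/-- `transProb p a x y` is the probability that a player who enters a round on arm `x` and
performs the action `a` pulls arm `y` on that round. -/
noncomputable def transProb (p : ℝ) : Move → Arm → Arm → ℝ
  | .stay, x, y => if x = y then 1 else 0
  | .switch, .reference, .reference => 0
  | .switch, .reference, .decoy => 1
  | .switch, .decoy, .reference => p
  | .switch, .decoy, .decoy => 1 - p

/-- An arm path `x : Fin (T + 1) → Arm` lists the initial arm `x 0` and then the arm pulled on each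
of the `T` rounds: `x t.succ` is the arm pulled on round `t : Fin T`, and `x t.castSucc` is the arm
on which the player enters that round.
`observed r x t` is the feedback of the player before round `t`: the rewards obtained on the
earlier rounds. -/
def observed {T : ℕ} (r : Fin T → Arm → ℝ) (x : Fin (T + 1) → Arm) (t : Fin T) :
    Fin t.val → ℝ :=
  fun s => r (s.castLE t.isLt.le) (x (s.castLE t.isLt.le).succ)

/-- The probability of the arm path `x` when the deterministic player `A` faces the oblivious
rewards `r` (`r t i` is the reward of arm `i` on round `t`) in the hidden bandit model with
parameter `p`. -/
noncomputable def pathProb (p : ℝ) {T : ℕ} (A : Player T) (r : Fin T → Arm → ℝ)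
    (x : Fin (T + 1) → Arm) : ℝ :=
  initProb p (x 0) *
    ∏ t : Fin T, transProb p (A t (observed r x t)) (x t.castSucc) (x t.succ)

/-- The expected regret of the deterministic player `A` on the oblivious rewards `r`, with respect
to the reference arm; the expectation is over the randomness of the initial arm and of the
switches. -/
noncomputable def expectedRegret (p : ℝ) {T : ℕ} (A : Player T) (r : Fin T → Arm → ℝ) : ℝ :=
  ∑ t : Fin T, r t .reference -
    ∑ x : Fin (T + 1) → Arm, pathProb p A r x * ∑ t : Fin T, r t (x t.succ)

/-- The parent function `ρ(t) = t - 2 ^ δ(t)` for `t ≥ 1`, where `2 ^ δ(t)` is the largest power of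
two that divides `t`. -/
def parent (t : ℕ) : ℕ := t - 2 ^ padicValNat 2 t

/-- The multi-scale random walk with `W 0 = 0` and `W t = W (ρ t) + ξ_t` for `t ≥ 1`. The steps
`ξ_1, ξ_2, …` are given as `ξ 0, ξ 1, …`. -/
def mrw (ξ : ℕ → ℝ) : ℕ → ℝ
  | 0 => 0
  | t + 1 => mrw ξ (parent (t + 1)) + ξ t
termination_by t => t
decreasing_by exact Nat.sub_lt (Nat.succ_pos t) (by positivity)

/-- The offset `ε = 1 / (320 (log₂ T)^(3/2))`. -/
noncomputable def epsilon (T : ℕ) : ℝ := 1 / (320 * Real.logb 2 T ^ (3 / 2 : ℝ))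

/-- The parameter `γ = 1 / (4 log₂ T)`. -/
noncomputable def gam (T : ℕ) : ℝ := 1 / (4 * Real.logb 2 T)

/-- The two-sided geometric weights on the integers. -/
noncomputable def geomWeight (γ : ℝ) (n : ℤ) : ℝ :=
  (1 - Real.exp (-γ)) / (1 + Real.exp (-γ)) * Real.exp (-γ * |(n : ℝ)|)

/-- The two-sided geometric distribution on the integers. -/
noncomputable def geomLaw (γ : ℝ) : Measure ℤ :=
  Measure.sum fun n : ℤ => ENNReal.ofReal (geomWeight γ n) • Measure.dirac n

theorem hasSum_geomWeight {γ : ℝ} (hγ : 0 < γ) : HasSum (geomWeight γ) 1 := by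
  set q := Real.exp (-γ) with hq
  have hq0 : 0 < q := Real.exp_pos _
  have hq1 : q < 1 := by rw [hq, Real.exp_lt_one_iff]; linarith
  have hg : HasSum (fun n : ℕ => q ^ n) (1 - q)⁻¹ := hasSum_geometric_of_lt_one hq0.le hq1
  have h1 : HasSum (fun n : ℕ => Real.exp (-γ * |((n : ℤ) : ℝ)|)) (1 - q)⁻¹ := by
    refine hg.congr_fun fun n => ?_
    rw [hq, ← Real.exp_nat_mul]
    congr 1
    simp
    ring
  have h2 : HasSum (fun n : ℕ => Real.exp (-γ * |((-((n : ℤ) + 1) : ℤ) : ℝ)|))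
      (q * (1 - q)⁻¹) := by
    refine (hg.mul_left q).congr_fun fun n => ?_
    rw [← pow_succ', hq, ← Real.exp_nat_mul]
    congr 1
    have : |((-((n : ℤ) + 1) : ℤ) : ℝ)| = (n : ℝ) + 1 := by
      push_cast
      rw [abs_neg, abs_of_nonneg (by positivity)]
    rw [this]
    push_cast
    ring
  have h3 := (HasSum.of_nat_of_neg_add_one (f := fun n : ℤ => Real.exp (-γ * |(n : ℝ)|))
    h1 h2).mul_left ((1 - q) / (1 + q))
  have e1 : 1 - q ≠ 0 := by linarith
  have e2 : 1 + q ≠ 0 := by linarith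
  have e : (1 - q) / (1 + q) * ((1 - q)⁻¹ + q * (1 - q)⁻¹) = 1 := by
    field_simp
  rw [e] at h3
  exact h3

theorem isProbabilityMeasure_geomLaw {γ : ℝ} (hγ : 0 < γ) : IsProbabilityMeasure (geomLaw γ) := by
  have hw : ∀ n, 0 ≤ geomWeight γ n := fun n => by
    have : Real.exp (-γ) < 1 := by rw [Real.exp_lt_one_iff]; linarith
    have : 0 ≤ 1 - Real.exp (-γ) := by linarith
    unfold geomWeight
    positivity
  refine ⟨?_⟩
  rw [geomLaw, Measure.sum_apply _ MeasurableSet.univ]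
  simp only [Measure.smul_apply, measure_univ, smul_eq_mul, mul_one]
  rw [← ENNReal.ofReal_tsum_of_nonneg hw (hasSum_geomWeight hγ).summable,
    (hasSum_geomWeight hγ).tsum_eq, ENNReal.ofReal_one]

/-- The law of `T` independent integer variables `n_1, …, n_T` with the two-sided geometric
distribution of parameter `γ`; the steps of the walk are `ξ_t = ε n_t`. -/
noncomputable def stepLaw (T : ℕ) : Measure (Fin T → ℤ) :=
  Measure.pi fun _ => geomLaw (gam T)

/-- The walk `W` with steps `ξ_t = ε n_t`, `1 ≤ t ≤ T`. -/
noncomputable def walk (T : ℕ) (n : Fin T → ℤ) : ℕ → ℝ :=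
  mrw fun i => if h : i < T then epsilon T * n ⟨i, h⟩ else 0

/-- Clipping to the interval `[0, 1]`. -/
noncomputable def clip (a : ℝ) : ℝ := min (max a 0) 1

/-- The clipped reward sequence. The round `t : Fin T` carries the number `t + 1` in the walk. -/
noncomputable def walkReward (T : ℕ) (n : Fin T → ℤ) (t : Fin T) (i : Arm) : ℝ :=
  clip (1 / 2 + walk T n (t.val + 1) - if i = .reference then 0 else epsilon T)

end HiddenBandit

open HiddenBandit

/-! The player cannot tell which arm he is on. Fix his actions and take a path that ends on the
reference arm. Moving its stretch since the last switch to the decoy arm does not make it less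
likely: for `p = 1/2` a switch reaches the decoy arm with probability at least `1/2`, and initially
that arm has probability `2/3` (`exists_flipFrom`). The move lowers the rewards of the stretch by
`ε`; raising the walk by `ε` on that stretch restores the observations. Only steps whose tree edge
crosses the start of the stretch change. There are at most `log₂ T + 1` of them
(`card_crossing_le`), and each costs a factor at most `exp γ` in the geometric law. The total factor
is at most `exp (1/2) ≤ 2`, so in every round the decoy arm has probability at least `1/3`
(`third_le_integral_lastArmProb`).

To compare paths, the steps are translated by a path-dependent vector, `pathShift`, after which the
observations, hence the actions, no longer depend on the path.

Clipping hides the gap `ε` only when the walk is large. Each `W_t` is a sum of at most `log₂ T + 1`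
independent steps of variance of order `(ε/γ)²`, so `ε` of order `(log₂ T)^(-3/2)` keeps its second
moment below `1/1000` (`integral_walk_sq_le`). Each round then costs at least `ε/4`. Randomized
players follow by Fubini. -/

namespace HiddenBandit

/-! ### The tree of the multi-scale random walk -/

theorem parent_lt {t : ℕ} (ht : 0 < t) : parent t < t :=
  Nat.sub_lt ht (by positivity)

theorem two_pow_padicValNat_dvd (t : ℕ) : 2 ^ padicValNat 2 t ∣ t := pow_padicValNat_dvd

theorem parent_add_two_pow {t : ℕ} (ht : 0 < t) : parent t + 2 ^ padicValNat 2 t = t :=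
  Nat.sub_add_cancel (Nat.le_of_dvd ht (two_pow_padicValNat_dvd t))

/-- `t` is an odd multiple of `2 ^ δ(t)`; removing one copy leaves an even multiple. Hence
valuations increase strictly towards the root, which bounds the depth of the tree. -/
theorem two_pow_succ_dvd_parent {t : ℕ} (ht : 0 < t) :
    2 ^ (padicValNat 2 t + 1) ∣ parent t := by
  obtain ⟨c, hc⟩ := two_pow_padicValNat_dvd t
  have hodd : ¬ 2 ∣ c := by
    rintro ⟨d, rfl⟩
    exact pow_succ_padicValNat_not_dvd (p := 2) ht.ne' ⟨d, by rw [pow_succ, mul_assoc, ← hc]⟩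
  obtain ⟨d, hd⟩ : ∃ d, c = 2 * d + 1 := ⟨c / 2, by omega⟩
  refine ⟨d, ?_⟩
  have h := parent_add_two_pow ht
  have e : t = 2 ^ (padicValNat 2 t + 1) * d + 2 ^ padicValNat 2 t := by
    conv_lhs => rw [hc, hd]
    ring
  omega

theorem padicValNat_lt_padicValNat_parent {t : ℕ} (ht : 0 < t) (hp : 0 < parent t) :
    padicValNat 2 t < padicValNat 2 (parent t) :=
  (padicValNat_dvd_iff_le hp.ne').1 (two_pow_succ_dvd_parent ht)

theorem padicValNat_two_le_log {t u : ℕ} (h : t ≤ u) : padicValNat 2 t ≤ Nat.log 2 u :=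
  (padicValNat_le_nat_log t).trans (Nat.log_mono_right h)

/-- Two numbers with the same 2-adic valuation do not have intersecting edges to their parents. -/
theorem le_parent_of_padicValNat_eq {u v : ℕ} (hu : 0 < u) (huv : u < v)
    (h : padicValNat 2 u = padicValNat 2 v) : u ≤ parent v := by
  have hv : 0 < v := hu.trans huv
  have h1 := parent_add_two_pow hu
  have h2 := parent_add_two_pow hv
  obtain ⟨a, ha⟩ := two_pow_succ_dvd_parent hu
  obtain ⟨b, hb⟩ := two_pow_succ_dvd_parent hv
  rw [h] at h1 ha
  set i := padicValNat 2 v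
  -- With common valuation `i`, the parents are `2^(i+1) a < 2^(i+1) b`, hence at least `2^(i+1)`
  -- apart, while `u` lies only `2^i` above its parent.
  have hab : a < b := by
    have : 2 ^ (i + 1) * a < 2 ^ (i + 1) * b := by omega
    exact lt_of_mul_lt_mul_left this (by positivity)
  have h3 : 2 ^ (i + 1) * (a + 1) ≤ 2 ^ (i + 1) * b := Nat.mul_le_mul_left _ hab
  have h4 : 2 ^ i ≤ 2 ^ (i + 1) := Nat.pow_le_pow_right (by norm_num) (by omega)
  rw [mul_add, mul_one] at h3
  omega

/-- The cut at `s` is crossed by at most `log₂ T + 1` edges of the tree. -/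
theorem card_crossing_le (T s : ℕ) (S : Finset (Fin T))
    (hS : ∀ i ∈ S, parent (i + 1) < s ∧ s ≤ i + 1) : S.card ≤ Nat.log 2 T + 1 := by
  rw [← Finset.card_range (Nat.log 2 T + 1)]
  refine Finset.card_le_card_of_injOn (fun i => padicValNat 2 (i + 1)) (fun i _ => ?_) ?_
  · simp only [Finset.coe_range, Set.mem_Iio]
    exact Nat.lt_succ_of_le (padicValNat_two_le_log i.isLt)
  · intro i hi j hj hij
    have hi' := hS i hi
    have hj' := hS j hj
    by_contra hne
    rcases lt_or_gt_of_ne (fun e => hne (Fin.ext e) : i.val ≠ j.val) with hlt | hlt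
    · have := le_parent_of_padicValNat_eq (Nat.succ_pos _) (Nat.succ_lt_succ hlt) hij
      simp only [Nat.succ_eq_add_one] at this
      omega
    · have := le_parent_of_padicValNat_eq (Nat.succ_pos _) (Nat.succ_lt_succ hlt) hij.symm
      simp only [Nat.succ_eq_add_one] at this
      omega

theorem mrw_zero (ξ : ℕ → ℝ) : mrw ξ 0 = 0 := by rw [mrw]

theorem mrw_succ (ξ : ℕ → ℝ) (t : ℕ) : mrw ξ (t + 1) = mrw ξ (parent (t + 1)) + ξ t := by
  rw [mrw]

/-- Increments of a potential `c` along the edges telescope on the way to the root, where `c`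
vanishes. -/
theorem mrw_add_telescope {ξ η : ℕ → ℝ} {c : ℕ → ℝ} {k : ℕ} (hc : c 0 = 0)
    (h : ∀ i < k, η i = ξ i + (c (i + 1) - c (parent (i + 1)))) :
    ∀ t ≤ k, mrw η t = mrw ξ t + c t := by
  intro t
  induction t using Nat.strong_induction_on with
  | _ t ih =>
    intro ht
    rcases t with _ | t
    · simp [mrw_zero, hc]
    · have hp := parent_lt (Nat.succ_pos t)
      rw [mrw_succ, mrw_succ, ih _ hp (hp.le.trans ht), h t ht]
      ring

/-- `S` lists the edges from `t` to the root. The valuation is added to the cardinality so that the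
induction closes: passing to the parent removes one edge and raises the valuation by at least one.
-/
theorem exists_mrw_eq_sum (t : ℕ) : ∃ S : Finset ℕ, S ⊆ Finset.range t ∧
    (0 < t → S.card + padicValNat 2 t ≤ Nat.log 2 t + 1) ∧ ∀ ξ, mrw ξ t = ∑ i ∈ S, ξ i := by
  induction t using Nat.strong_induction_on with
  | _ t ih =>
    rcases t with _ | t
    · exact ⟨∅, by simp, by simp, fun ξ => by simp [mrw_zero]⟩
    · have hp : parent (t + 1) < t + 1 := parent_lt (Nat.succ_pos t)
      obtain ⟨S, hS, hcard, hsum⟩ := ih _ hp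
      have hnot : t ∉ S := fun h => by
        have := Finset.mem_range.1 (hS h)
        omega
      refine ⟨insert t S, ?_, fun _ => ?_, fun ξ => ?_⟩
      · intro i hi
        rcases Finset.mem_insert.1 hi with rfl | hi
        · simp
        · have := Finset.mem_range.1 (hS hi)
          simp only [Finset.mem_range]
          omega
      · rw [Finset.card_insert_of_notMem hnot]
        rcases Nat.eq_zero_or_pos (parent (t + 1)) with h0 | hpos
        · rw [h0, Finset.range_zero, Finset.subset_empty] at hS
          have := padicValNat_le_nat_log (p := 2) (t + 1)
          simp [hS]
          omega
        · have h1 := hcard hpos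
          have h2 := padicValNat_lt_padicValNat_parent (Nat.succ_pos t) hpos
          have h3 : Nat.log 2 (parent (t + 1)) ≤ Nat.log 2 (t + 1) := Nat.log_mono_right hp.le
          simp only [Nat.succ_eq_add_one] at h2
          omega
      · rw [mrw_succ, hsum, Finset.sum_insert hnot, add_comm]

/-! ### Truncation of a player to the first rounds -/

/-- The player who stops after `k` rounds. -/
def Player.take {T : ℕ} (A : Player T) {k : ℕ} (h : k ≤ T) : Player k :=
  fun t => A (t.castLE h)

theorem initProb_nonneg {p : ℝ} (hp : 0 ≤ p) (x : Arm) : 0 ≤ initProb p x := by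
  cases x <;> simp only [initProb] <;> positivity

theorem transProb_nonneg {p : ℝ} (hp : 0 ≤ p) (hp1 : p ≤ 1) (a : Move) (x y : Arm) :
    0 ≤ transProb p a x y := by
  cases a <;> cases x <;> cases y <;> simp [transProb, hp, hp1]

theorem sum_arm (f : Arm → ℝ) : ∑ x, f x = f .reference + f .decoy := by
  have : (Finset.univ : Finset Arm) = {.reference, .decoy} := rfl
  rw [this, Finset.sum_pair (by simp)]

theorem sum_initProb {p : ℝ} (hp : 0 ≤ p) : ∑ x, initProb p x = 1 := by
  rw [sum_arm]
  simp only [initProb]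
  field_simp
  ring

theorem sum_transProb (p : ℝ) (a : Move) (x : Arm) : ∑ y, transProb p a x y = 1 := by
  rw [sum_arm]
  cases a <;> cases x <;> simp [transProb]

theorem pathProb_nonneg {p : ℝ} (hp : 0 ≤ p) (hp1 : p ≤ 1) {T : ℕ} (A : Player T)
    (r : Fin T → Arm → ℝ) (x : Fin (T + 1) → Arm) : 0 ≤ pathProb p A r x :=
  mul_nonneg (initProb_nonneg hp _) (Finset.prod_nonneg fun _ _ => transProb_nonneg hp hp1 _ _ _)

theorem sum_snoc {α : Type*} [Fintype α] {n : ℕ} (f : (Fin (n + 1) → α) → ℝ) :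
    ∑ x, f x = ∑ y : Fin n → α, ∑ z, f (Fin.snoc y z) := by
  rw [← (Fin.snocEquiv fun _ => α).sum_comp, Fintype.sum_prod_type, Finset.sum_comm]
  rfl

theorem pathProb_snoc (p : ℝ) {T : ℕ} (A : Player (T + 1)) (r : Fin (T + 1) → Arm → ℝ)
    (y : Fin (T + 1) → Arm) (z : Arm) :
    pathProb p A r (Fin.snoc y z) =
      pathProb p (A.take T.le_succ) (fun t => r t.castSucc) y *
        transProb p (A (Fin.last T) (observed r (Fin.snoc y z) (Fin.last T))) (y (Fin.last T)) z ∧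
    observed r (Fin.snoc y z) (Fin.last T) = fun s => r s.castSucc (y s.succ) := by
  have key : ∀ (t : Fin T), (Fin.snoc y z : Fin (T + 2) → Arm) t.castSucc.succ = y t.succ := by
    intro t
    rw [Fin.succ_castSucc, Fin.snoc_castSucc]
  refine ⟨?_, ?_⟩
  · unfold pathProb
    rw [Fin.prod_univ_castSucc, ← mul_assoc]
    congr 1
    · congr 1
      refine Finset.prod_congr rfl fun t _ => ?_
      rw [key, Fin.snoc_castSucc]
      congr 1
      unfold Player.take observed
      congr 1
      funext s
      exact congrArg _ (key (s.castLE t.isLt.le))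
    · rw [Fin.succ_last, Fin.snoc_last, Fin.snoc_castSucc]
  · funext s
    exact congrArg _ (key s)

/-- The first `k` rounds of the game do not depend on the later ones. -/
theorem sum_pathProb_take (p : ℝ) {k T : ℕ} (h : k ≤ T) (A : Player T)
    (r : Fin T → Arm → ℝ) (f : (Fin (k + 1) → Arm) → ℝ) :
    ∑ x, pathProb p A r x * f (fun i => x (i.castLE (Nat.succ_le_succ h))) =
      ∑ y, pathProb p (A.take h) (fun t => r (t.castLE h)) y * f y := by
  induction T, h using Nat.le_induction with
  | base => rfl
  | succ T h ih =>
    rw [sum_snoc]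
    have h1 : ∀ (y : Fin (T + 1) → Arm) (z : Arm),
        (fun i : Fin (k + 1) => (Fin.snoc y z : Fin (T + 2) → Arm)
          (i.castLE (Nat.succ_le_succ (h.trans T.le_succ)))) =
        fun i => y (i.castLE (Nat.succ_le_succ h)) := by
      intro y z
      funext i
      exact Fin.snoc_castSucc (α := fun _ => Arm) z y (i.castLE (Nat.succ_le_succ h))
    refine Eq.trans (Finset.sum_congr rfl fun y _ => ?_)
      (ih (A.take T.le_succ) (fun t => r t.castSucc))
    simp only [h1]
    rw [← Finset.sum_mul]
    congr 1
    simp only [(pathProb_snoc p A r y _).1, (pathProb_snoc p A r y _).2]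
    rw [← Finset.mul_sum, sum_transProb, mul_one]

theorem sum_pathProb {p : ℝ} (hp : 0 ≤ p) {T : ℕ} (A : Player T) (r : Fin T → Arm → ℝ) :
    ∑ x, pathProb p A r x = 1 := by
  have h := sum_pathProb_take p T.zero_le A r (fun _ => 1)
  simp only [mul_one] at h
  rw [h, ← sum_initProb hp, ← (Equiv.funUnique (Fin 1) Arm).symm.sum_comp]
  simp [pathProb]

/-! ### Moving the last stretch of a path to the other arm -/

/-- The other arm. -/
def Arm.other : Arm → Arm
  | .reference => .decoy
  | .decoy => .reference

theorem Arm.other_other (x : Arm) : x.other.other = x := by cases x <;> rfl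

/-- The path that is moved to the other arm from the index `s` on. -/
def flipFrom (s : ℕ) {n : ℕ} (y : Fin n → Arm) : Fin n → Arm :=
  fun i => if s ≤ i.val then (y i).other else y i

theorem flipFrom_involutive (s n : ℕ) : Function.Involutive (flipFrom s (n := n)) := by
  intro y
  funext i
  by_cases h : s ≤ i.val <;> simp [flipFrom, h, Arm.other_other]

/-- For fixed actions, every path that ends on the reference arm is at most as likely as the path
that is moved to the decoy arm from the last switch on. -/
theorem exists_flipFrom (k : ℕ) (a : Fin k → Move) : ∃ s ≤ k, ∀ y : Fin (k + 1) → Arm,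
    y (Fin.last k) = .reference →
      initProb (1 / 2) (y 0) * ∏ t : Fin k, transProb (1 / 2) (a t) (y t.castSucc) (y t.succ) ≤
        initProb (1 / 2) (flipFrom s y 0) * ∏ t : Fin k, transProb (1 / 2) (a t)
          (flipFrom s y t.castSucc) (flipFrom s y t.succ) ∧
      (initProb (1 / 2) (y 0) *
          ∏ t : Fin k, transProb (1 / 2) (a t) (y t.castSucc) (y t.succ) ≠ 0 →
        ∀ i : Fin (k + 1), s ≤ i.val → y i = .reference) := by
  induction k with
  | zero =>
    refine ⟨0, le_rfl, fun y hy => ?_⟩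
    have h0 : y 0 = .reference := hy
    refine ⟨?_, fun _ i _ => ?_⟩
    · simp [flipFrom, h0, Arm.other, initProb]
      norm_num
    · rw [(Fin.ext (by omega) : i = 0), h0]
  | succ k ih =>
    obtain ⟨s, hs, ih⟩ := ih (fun t => a t.castSucc)
    have hnn : ∀ y : Fin (k + 1) → Arm, 0 ≤ initProb (1 / 2) (y 0) *
        ∏ t : Fin k, transProb (1 / 2) (a t.castSucc) (y t.castSucc) (y t.succ) := fun y =>
      mul_nonneg (initProb_nonneg (by norm_num) _)
        (Finset.prod_nonneg fun _ _ => transProb_nonneg (by norm_num) (by norm_num) _ _ _)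
    have hsplit : ∀ y : Fin (k + 2) → Arm, initProb (1 / 2) (y 0) *
        ∏ t : Fin (k + 1), transProb (1 / 2) (a t) (y t.castSucc) (y t.succ) =
        (initProb (1 / 2) (y (Fin.castSucc 0)) * ∏ t : Fin k, transProb (1 / 2) (a t.castSucc)
          (y t.castSucc.castSucc) (y t.succ.castSucc)) *
        transProb (1 / 2) (a (Fin.last k)) (y (Fin.last k).castSucc) (y (Fin.last (k + 1))) := by
      intro y
      rw [Fin.prod_univ_castSucc, ← mul_assoc]
      rfl
    rcases ha : a (Fin.last k) with _ | _
    -- A stay prolongs the current stretch, so `s` is kept; a path that was on the decoy arm before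
    -- the stay cannot end on the reference arm and has weight zero.
    · refine ⟨s, hs.trans k.le_succ, fun y hy => ?_⟩
      simp only [hsplit, ha]
      have hfl : flipFrom s y (Fin.last (k + 1)) = .decoy := by
        simp [flipFrom, hs.trans k.le_succ, hy, Arm.other]
      have hfk : flipFrom s y (Fin.last k).castSucc = (y (Fin.last k).castSucc).other := by
        simp [flipFrom, hs]
      rcases hyk : y (Fin.last k).castSucc with _ | _
      · obtain ⟨h1, h2⟩ := ih (fun i => y i.castSucc) hyk
        rw [hfl, hfk, hyk, hy]
        simp only [transProb, Arm.other, if_true, mul_one]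
        refine ⟨h1, fun hne i hi => ?_⟩
        refine Fin.lastCases ?_ (fun i => ?_) i hi
        · exact fun _ => hy
        · exact fun hi => h2 hne i hi
      · have h0 : transProb (1 / 2) .stay .decoy (y (Fin.last (k + 1))) = 0 := by
          simp [hy, transProb]
        rw [h0, mul_zero]
        refine ⟨mul_nonneg ?_ (transProb_nonneg (by norm_num) (by norm_num) _ _ _), by simp⟩
        exact hnn fun i => flipFrom s y i.castSucc
    -- A switch starts a new stretch, so only the last arm is flipped. From the reference arm the
    -- comparison is `0 ≤ 1`, from the decoy arm `p ≤ 1 - p`.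
    · refine ⟨k + 1, le_rfl, fun y hy => ⟨?_, fun _ i hi => ?_⟩⟩
      · simp only [hsplit, ha]
        have hlt : ∀ i : Fin (k + 1), flipFrom (k + 1) y i.castSucc = y i.castSucc := by
          intro i
          have := i.isLt
          simp [flipFrom]
          omega
        have hl : flipFrom (k + 1) y (Fin.last (k + 1)) = .decoy := by
          simp [flipFrom, hy, Arm.other]
        simp only [hlt, hl, hy]
        refine mul_le_mul_of_nonneg_left ?_ (hnn fun i => y i.castSucc)
        cases y (Fin.last k).castSucc <;> norm_num [transProb]
      · have : i = Fin.last (k + 1) := Fin.ext (le_antisymm (Nat.lt_succ_iff.1 i.isLt) hi)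
        rw [this, hy]

/-! ### Change of variables from the steps of the walk to the observations -/

/-- The indicator that the path `y` is on the decoy arm at the index `u ≥ 1`. -/
def onDecoy {k : ℕ} (y : Fin (k + 1) → Arm) (u : ℕ) : ℤ :=
  if h : u < k + 1 then if u ≠ 0 ∧ y ⟨u, h⟩ = .decoy then 1 else 0 else 0

/-- Adding `pathShift T y` to the steps raises the walk by one unit whenever `y` is on the
decoy arm. -/
def pathShift (T : ℕ) {k : ℕ} (y : Fin (k + 1) → Arm) : Fin T → ℤ :=
  fun i => if i.val < k then onDecoy y (i + 1) - onDecoy y (parent (i + 1)) else 0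

theorem walk_add_pathShift {T k : ℕ} (h : k ≤ T) (m : Fin T → ℤ) (y : Fin (k + 1) → Arm)
    {u : ℕ} (hu : u ≤ k) :
    walk T (m + pathShift T y) u = walk T m u + epsilon T * onDecoy y u := by
  refine mrw_add_telescope (c := fun u => epsilon T * (onDecoy y u : ℝ)) ?_ (fun i hi => ?_) u hu
  · simp [onDecoy]
  · have hT : i < T := hi.trans_le h
    simp only [hT, dite_true, Pi.add_apply, pathShift, hi, if_true]
    push_cast
    ring

/-- The shift cancels the gap `ε` exactly, before clipping. The right side is free of `y`, so for
fixed `m` all paths share the same actions. -/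
theorem observed_add_pathShift {T k : ℕ} (h : k ≤ T) (m : Fin T → ℤ) (y : Fin (k + 1) → Arm)
    (t : Fin k) :
    observed (fun t : Fin k => walkReward T (m + pathShift T y) (t.castLE h)) y t =
      fun s => clip (1 / 2 + walk T m (s.val + 1)) := by
  funext s
  have hs : s.val + 1 < k + 1 := by
    have := s.isLt
    have := t.isLt
    omega
  have e : (s.castLE t.isLt.le).succ = (⟨s.val + 1, hs⟩ : Fin (k + 1)) := rfl
  simp only [observed, walkReward]
  rw [e]
  simp only [Fin.val_castLE]
  rw [walk_add_pathShift h m y (Nat.lt_succ_iff.1 hs)]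
  congr 1
  rcases hy : y ⟨s.val + 1, hs⟩ with _ | _ <;> (simp [onDecoy, hs, hy]; try ring)

/-- The probability of the steps `n`. -/
noncomputable def stepWeight (γ : ℝ) {T : ℕ} (n : Fin T → ℤ) : ℝ := ∏ i, geomWeight γ (n i)

theorem geomWeight_nonneg {γ : ℝ} (hγ : 0 ≤ γ) (n : ℤ) : 0 ≤ geomWeight γ n := by
  have : Real.exp (-γ) ≤ 1 := by rw [Real.exp_le_one_iff]; linarith
  have : 0 ≤ 1 - Real.exp (-γ) := by linarith
  unfold geomWeight
  positivity

theorem stepWeight_nonneg {γ : ℝ} (hγ : 0 ≤ γ) {T : ℕ} (n : Fin T → ℤ) : 0 ≤ stepWeight γ n :=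
  Finset.prod_nonneg fun _ _ => geomWeight_nonneg hγ _

/-- The logarithm of the weight is `γ`-Lipschitz; this is the reason for choosing a geometric law.
-/
theorem geomWeight_le {γ : ℝ} (hγ : 0 ≤ γ) (a b : ℤ) :
    geomWeight γ a ≤ Real.exp (γ * |(b - a : ℝ)|) * geomWeight γ b := by
  have h1 : Real.exp (-γ) ≤ 1 := by rw [Real.exp_le_one_iff]; linarith
  have h2 : 0 ≤ (1 - Real.exp (-γ)) / (1 + Real.exp (-γ)) :=
    div_nonneg (by linarith) (by positivity)
  unfold geomWeight
  rw [mul_left_comm, ← Real.exp_add]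
  refine mul_le_mul_of_nonneg_left (Real.exp_le_exp.2 ?_) h2
  have h3 : |(b : ℝ)| - |(a : ℝ)| ≤ |(b - a : ℝ)| := abs_sub_abs_le_abs_sub _ _
  nlinarith

/-- The bound is `max s 1` because index `0` is the initial arm, which yields no reward and is the
root of the tree. -/
theorem onDecoy_flipFrom {k s : ℕ} {y : Fin (k + 1) → Arm}
    (hy : ∀ i : Fin (k + 1), s ≤ i.val → y i = .reference) {u : ℕ} (hu : u ≤ k) :
    onDecoy (flipFrom s y) u = onDecoy y u + if max s 1 ≤ u then 1 else 0 := by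
  have hk : u < k + 1 := Nat.lt_succ_of_le hu
  rcases Nat.eq_zero_or_pos u with rfl | hpos
  · simp [onDecoy]
  · have h1 : max s 1 ≤ u ↔ s ≤ u := by omega
    simp only [onDecoy, hk, dite_true, flipFrom, h1, hpos.ne', ne_eq, not_false_eq_true, true_and]
    by_cases hs : s ≤ u
    · simp [hs, hy ⟨u, hk⟩ hs, Arm.other]
    · simp [hs]

/-- The flip adds the indicator of `[max s 1, k]` to the potential, so a step changes, by one unit,
only if its edge crosses the cut at `max s 1`. -/
theorem stepWeight_pathShift_le {γ : ℝ} (hγ : 0 ≤ γ) {T k s : ℕ} (m : Fin T → ℤ)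
    {y : Fin (k + 1) → Arm} (hy : ∀ i : Fin (k + 1), s ≤ i.val → y i = .reference) :
    stepWeight γ (m + pathShift T y) ≤ Real.exp (γ * (Nat.log 2 T + 1)) *
      stepWeight γ (m + pathShift T (flipFrom s y)) := by
  classical
  set S : Finset (Fin T) :=
    Finset.univ.filter fun i => parent (i + 1) < max s 1 ∧ max s 1 ≤ i.val + 1
  have hcard : S.card ≤ Nat.log 2 T + 1 :=
    card_crossing_le T (max s 1) S fun i hi => (Finset.mem_filter.1 hi).2
  have hstep : ∀ i : Fin T, geomWeight γ ((m + pathShift T y) i) ≤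
      (if i ∈ S then Real.exp γ else 1) *
        geomWeight γ ((m + pathShift T (flipFrom s y)) i) := by
    intro i
    refine (geomWeight_le hγ _ ((m + pathShift T (flipFrom s y)) i)).trans
      (mul_le_mul_of_nonneg_right ?_ (geomWeight_nonneg hγ _))
    have hp : parent (i.val + 1) < i.val + 1 := parent_lt (Nat.succ_pos _)
    have hd : ∃ d : ℤ, (m + pathShift T (flipFrom s y)) i = (m + pathShift T y) i + d ∧
        |d| ≤ if i ∈ S then 1 else 0 := by
      by_cases hi : i.val < k
      · refine ⟨(if max s 1 ≤ i.val + 1 then 1 else 0) -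
          (if max s 1 ≤ parent (i.val + 1) then 1 else 0), ?_, ?_⟩
        · simp only [Pi.add_apply, pathShift, hi, if_true]
          rw [onDecoy_flipFrom hy (u := i.val + 1) hi,
            onDecoy_flipFrom hy (u := parent (i.val + 1)) (by omega)]
          ring
        · have hmem : i ∈ S ↔ parent (i.val + 1) < max s 1 ∧ max s 1 ≤ i.val + 1 := by
            simp [S]
          simp only [hmem]
          by_cases h1 : max s 1 ≤ i.val + 1 <;> by_cases h2 : max s 1 ≤ parent (i.val + 1)
          · rw [if_pos h1, if_pos h2, sub_self, abs_zero]
            split_ifs <;> norm_num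
          · simp only [h1, h2, if_true, if_false]
            rw [if_pos ⟨not_le.1 h2, trivial⟩]
            norm_num
          · omega
          · simp [h1, h2]
      · refine ⟨0, by simp [pathShift, hi], ?_⟩
        split_ifs <;> simp
    obtain ⟨d, hd, hd'⟩ := hd
    rw [hd]
    push_cast
    rw [add_sub_cancel_left]
    have hd2 : |(d : ℝ)| ≤ if i ∈ S then 1 else 0 := by exact_mod_cast hd'
    split_ifs at hd2 ⊢ with hS
    · exact Real.exp_le_exp.2 (by nlinarith)
    · rw [Real.exp_le_one_iff]
      nlinarith
  unfold stepWeight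
  refine (Finset.prod_le_prod (fun i _ => geomWeight_nonneg hγ _) fun i _ => hstep i).trans ?_
  rw [Finset.prod_mul_distrib]
  refine mul_le_mul_of_nonneg_right ?_ (stepWeight_nonneg hγ _)
  rw [Finset.prod_ite_mem, Finset.univ_inter, Finset.prod_const, ← Real.exp_nat_mul]
  refine Real.exp_le_exp.2 ?_
  have : (S.card : ℝ) ≤ Nat.log 2 T + 1 := by exact_mod_cast hcard
  nlinarith

/-- Given the observations, the reference arm is not much more likely than the decoy arm. -/
theorem sum_reference_le_sum_decoy {γ : ℝ} (hγ : 0 ≤ γ) {T k : ℕ} (h : k ≤ T) (A : Player k)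
    (m : Fin T → ℤ) :
    ∑ y : Fin (k + 1) → Arm, (if y (Fin.last k) = .reference then
        stepWeight γ (m + pathShift T y) *
          pathProb (1 / 2) A (fun t => walkReward T (m + pathShift T y) (t.castLE h)) y else 0) ≤
      Real.exp (γ * (Nat.log 2 T + 1)) *
        ∑ y : Fin (k + 1) → Arm, (if y (Fin.last k) = .decoy then
          stepWeight γ (m + pathShift T y) *
            pathProb (1 / 2) A (fun t => walkReward T (m + pathShift T y) (t.castLE h)) y
          else 0) := by
  obtain ⟨s, hs, hflip⟩ :=
    exists_flipFrom k fun t => A t fun s => clip (1 / 2 + walk T m (s.val + 1))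
  let e : Equiv.Perm (Fin (k + 1) → Arm) := (flipFrom_involutive s (k + 1)).toPerm
  rw [← Equiv.sum_comp e fun y : Fin (k + 1) → Arm =>
    if y (Fin.last k) = .decoy then stepWeight γ (m + pathShift T y) *
      pathProb (1 / 2) A (fun t => walkReward T (m + pathShift T y) (t.castLE h)) y else 0,
    Finset.mul_sum]
  refine Finset.sum_le_sum fun y _ => ?_
  have hlast : e y (Fin.last k) = (y (Fin.last k)).other := by
    change flipFrom s y _ = _
    simp [flipFrom, hs]
  rw [hlast]
  rcases hy : y (Fin.last k) with _ | _
  · simp only [Arm.other, if_true]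
    change _ ≤ Real.exp _ * (stepWeight γ (m + pathShift T (flipFrom s y)) *
      pathProb (1 / 2) A
        (fun t => walkReward T (m + pathShift T (flipFrom s y)) (t.castLE h)) (flipFrom s y))
    have hrw : ∀ y : Fin (k + 1) → Arm,
        pathProb (1 / 2) A (fun t => walkReward T (m + pathShift T y) (t.castLE h)) y =
        initProb (1 / 2) (y 0) * ∏ t : Fin k, transProb (1 / 2)
          (A t fun s => clip (1 / 2 + walk T m (s.val + 1))) (y t.castSucc) (y t.succ) := by
      intro y
      simp only [pathProb, observed_add_pathShift]
    obtain ⟨h1, h2⟩ := hflip y hy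
    rw [← mul_assoc, hrw, hrw (flipFrom s y)]
    have hnn : 0 ≤ initProb (1 / 2) (flipFrom s y 0) * ∏ t : Fin k, transProb (1 / 2)
        (A t fun s => clip (1 / 2 + walk T m (s.val + 1)))
        (flipFrom s y t.castSucc) (flipFrom s y t.succ) :=
      mul_nonneg (initProb_nonneg (by norm_num) _)
        (Finset.prod_nonneg fun _ _ => transProb_nonneg (by norm_num) (by norm_num) _ _ _)
    -- Only paths of positive probability are known to be on the reference arm throughout the
    -- flipped stretch, as the comparison of step weights requires.
    by_cases h0 : initProb (1 / 2) (y 0) * ∏ t : Fin k, transProb (1 / 2)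
        (A t fun s => clip (1 / 2 + walk T m (s.val + 1))) (y t.castSucc) (y t.succ) = 0
    · rw [h0, mul_zero]
      exact mul_nonneg (mul_nonneg (Real.exp_pos _).le (stepWeight_nonneg hγ _)) hnn
    · refine (mul_le_mul_of_nonneg_left h1 (stepWeight_nonneg hγ _)).trans ?_
      exact mul_le_mul_of_nonneg_right (stepWeight_pathShift_le hγ m (h2 h0)) hnn
  · simp [Arm.other]

/-! ### Integration against the law of the steps -/

theorem one_le_logb {T : ℕ} (hT : 2 ≤ T) : 1 ≤ Real.logb 2 T := by
  rw [Real.le_logb_iff_rpow_le (by norm_num) (by positivity)]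
  simpa using (by exact_mod_cast hT : (2 : ℝ) ≤ T)

theorem gam_pos {T : ℕ} (hT : 2 ≤ T) : 0 < gam T := by
  have := one_le_logb hT
  unfold gam
  positivity

theorem natLog_add_one_le {T : ℕ} (hT : 2 ≤ T) : (Nat.log 2 T : ℝ) + 1 ≤ 2 * Real.logb 2 T := by
  have h1 := one_le_logb hT
  have h2 := Real.natLog_le_logb T 2
  push_cast at h2
  linarith

theorem isProbabilityMeasure_stepLaw {T : ℕ} (hT : 2 ≤ T) : IsProbabilityMeasure (stepLaw T) := by
  have := isProbabilityMeasure_geomLaw (gam_pos hT)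
  unfold stepLaw
  infer_instance

theorem geomLaw_singleton (γ : ℝ) (n : ℤ) :
    geomLaw γ {n} = ENNReal.ofReal (geomWeight γ n) := by
  rw [geomLaw, Measure.sum_smul_dirac_singleton]

theorem stepLaw_real_singleton {T : ℕ} (hT : 2 ≤ T) (n : Fin T → ℤ) :
    (stepLaw T).real {n} = stepWeight (gam T) n := by
  have := isProbabilityMeasure_geomLaw (gam_pos hT)
  rw [measureReal_def, stepLaw, Measure.pi_singleton, ENNReal.toReal_prod]
  refine Finset.prod_congr rfl fun i _ => ?_
  rw [geomLaw_singleton, ENNReal.toReal_ofReal (geomWeight_nonneg (gam_pos hT).le _)]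

theorem integrable_stepLaw {T : ℕ} (hT : 2 ≤ T) {f : (Fin T → ℤ) → ℝ} {C : ℝ}
    (hf : ∀ n, |f n| ≤ C) : Integrable f (stepLaw T) := by
  have := isProbabilityMeasure_stepLaw hT
  exact Integrable.of_bound (measurable_of_countable f).aestronglyMeasurable C
    (ae_of_all _ hf)

theorem integral_stepLaw {T : ℕ} (hT : 2 ≤ T) {f : (Fin T → ℤ) → ℝ} {C : ℝ}
    (hf : ∀ n, |f n| ≤ C) : ∫ n, f n ∂stepLaw T = ∑' n, stepWeight (gam T) n * f n := by
  rw [integral_countable (integrable_stepLaw hT hf)]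
  simp only [stepLaw_real_singleton hT, smul_eq_mul]

theorem summable_stepWeight {T : ℕ} (hT : 2 ≤ T) :
    Summable (fun n : Fin T → ℤ => stepWeight (gam T) n) := by
  have := isProbabilityMeasure_stepLaw hT
  simp only [← stepLaw_real_singleton hT, measureReal_def]
  refine ENNReal.summable_toReal ?_
  have h := Measure.tsum_indicator_apply_singleton (stepLaw T) Set.univ MeasurableSet.univ
  simp only [Set.indicator_univ, measure_univ] at h
  rw [h]
  exact ENNReal.one_ne_top

theorem summable_stepWeight_mul {T : ℕ} (hT : 2 ≤ T) {f : (Fin T → ℤ) → ℝ}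
    (hf : ∀ n, 0 ≤ f n) (hf1 : ∀ n, f n ≤ 1) :
    Summable (fun n => stepWeight (gam T) n * f n) :=
  (summable_stepWeight hT).of_nonneg_of_le
    (fun n => mul_nonneg (stepWeight_nonneg (gam_pos hT).le n) (hf n))
    (fun n => mul_le_of_le_one_right (stepWeight_nonneg (gam_pos hT).le n) (hf1 n))

/-- The steps may be translated by an amount that depends on the path. -/
theorem integral_sum_eq_tsum_sum {T : ℕ} (hT : 2 ≤ T) {ι : Type*} [Fintype ι]
    (F : (Fin T → ℤ) → ι → ℝ) (hF : ∀ n i, 0 ≤ F n i) (hF1 : ∀ n i, F n i ≤ 1)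
    (v : ι → Fin T → ℤ) :
    Summable (fun m => ∑ i, stepWeight (gam T) (m + v i) * F (m + v i) i) ∧
    ∫ n, ∑ i, F n i ∂stepLaw T =
      ∑' m, ∑ i, stepWeight (gam T) (m + v i) * F (m + v i) i := by
  have hs : ∀ i, Summable (fun m => stepWeight (gam T) (m + v i) * F (m + v i) i) := fun i =>
    (Equiv.addRight (v i)).summable_iff.2
      (summable_stepWeight_mul hT (f := fun n => F n i) (fun n => hF n i) (fun n => hF1 n i))
  have hb : ∀ i n, |F n i| ≤ 1 := fun i n => by
    rw [abs_of_nonneg (hF n i)]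
    exact hF1 n i
  refine ⟨summable_sum fun i _ => hs i, ?_⟩
  rw [integral_finsetSum _ fun i _ => integrable_stepLaw hT (hb i),
    Summable.tsum_finsetSum fun i _ => hs i]
  refine Finset.sum_congr rfl fun i _ => ?_
  rw [integral_stepLaw hT (hb i)]
  exact ((Equiv.addRight (v i)).tsum_eq fun n => stepWeight (gam T) n * F n i).symm

theorem pathProb_le_one {T : ℕ} (A : Player T) (r : Fin T → Arm → ℝ) (x : Fin (T + 1) → Arm) :
    pathProb (1 / 2) A r x ≤ 1 := by
  refine le_of_le_of_eq ?_ (sum_pathProb (p := 1 / 2) (by norm_num) A r)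
  exact Finset.single_le_sum (f := fun x => pathProb (1 / 2) A r x)
    (fun x _ => pathProb_nonneg (by norm_num) (by norm_num) A r x) (Finset.mem_univ x)

/-- The probability that the player is on the arm `i` after `k` rounds. -/
noncomputable def lastArmProb {k : ℕ} (A : Player k) (r : Fin k → Arm → ℝ) (i : Arm) : ℝ :=
  ∑ y : Fin (k + 1) → Arm, if y (Fin.last k) = i then pathProb (1 / 2) A r y else 0

theorem lastArmProb_nonneg {k : ℕ} (A : Player k) (r : Fin k → Arm → ℝ) (i : Arm) :
    0 ≤ lastArmProb A r i :=
  Finset.sum_nonneg fun y _ => by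
    split_ifs
    exacts [pathProb_nonneg (by norm_num) (by norm_num) A r y, le_rfl]

theorem lastArmProb_add {k : ℕ} (A : Player k) (r : Fin k → Arm → ℝ) :
    lastArmProb A r .reference + lastArmProb A r .decoy = 1 := by
  rw [← sum_pathProb (p := 1 / 2) (by norm_num) A r]
  unfold lastArmProb
  rw [← Finset.sum_add_distrib]
  refine Finset.sum_congr rfl fun y _ => ?_
  rcases y (Fin.last k) with _ | _ <;> simp

theorem lastArmProb_le_one {k : ℕ} (A : Player k) (r : Fin k → Arm → ℝ) :
    lastArmProb A r .decoy ≤ 1 := by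
  linarith [lastArmProb_add A r, lastArmProb_nonneg A r .reference]

theorem exp_half_le : Real.exp (1 / 2) ≤ 2 := by
  have h : Real.exp (1 / 2) * Real.exp (1 / 2) = Real.exp 1 := by
    rw [← Real.exp_add]
    norm_num
  nlinarith [Real.exp_one_lt_d9, Real.exp_pos (1 / 2)]

/-- Against the multi-scale random walk, the player is on the decoy arm with at least constant
probability in each round. -/
theorem third_le_integral_lastArmProb {T k : ℕ} (hT : 2 ≤ T) (h : k ≤ T) (A : Player k) :
    1 / 3 ≤ ∫ n, lastArmProb A (fun t => walkReward T n (t.castLE h)) .decoy ∂stepLaw T := by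
  have hμ := isProbabilityMeasure_stepLaw hT
  have hb : ∀ i n, |lastArmProb A (fun t => walkReward T n (t.castLE h)) i| ≤ 1 := by
    intro i n
    have h1 := lastArmProb_add A (fun t => walkReward T n (t.castLE h))
    have h2 := lastArmProb_nonneg A (fun t => walkReward T n (t.castLE h))
    rw [abs_of_nonneg (h2 i)]
    cases i <;> linarith [h2 .reference, h2 .decoy]
  have hsum : ∫ n, lastArmProb A (fun t => walkReward T n (t.castLE h)) .reference ∂stepLaw T +
      ∫ n, lastArmProb A (fun t => walkReward T n (t.castLE h)) .decoy ∂stepLaw T = 1 := by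
    rw [← integral_add (integrable_stepLaw hT (hb _)) (integrable_stepLaw hT (hb _))]
    simp [lastArmProb_add]
  have hkey := fun i => integral_sum_eq_tsum_sum hT
    (fun n (y : Fin (k + 1) → Arm) => if y (Fin.last k) = i then
      pathProb (1 / 2) A (fun t => walkReward T n (t.castLE h)) y else 0)
    (fun n y => by
      split_ifs
      exacts [pathProb_nonneg (by norm_num) (by norm_num) A _ y, le_rfl])
    (fun n y => by
      split_ifs
      exacts [pathProb_le_one A _ y, zero_le_one])
    (fun y => pathShift T y)
  simp only [mul_ite, mul_zero] at hkey
  have hle : ∫ n, lastArmProb A (fun t => walkReward T n (t.castLE h)) .reference ∂stepLaw T ≤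
      2 * ∫ n, lastArmProb A (fun t => walkReward T n (t.castLE h)) .decoy ∂stepLaw T := by
    -- The exponent is at most `(1 / (4 log₂ T)) * 2 log₂ T = 1/2`.
    have hexp : Real.exp (gam T * (Nat.log 2 T + 1)) ≤ 2 := by
      refine (Real.exp_le_exp.2 ?_).trans exp_half_le
      have h1 := one_le_logb hT
      have h2 := natLog_add_one_le hT
      rw [gam, div_mul_eq_mul_div, one_mul, div_le_iff₀ (by positivity)]
      linarith
    refine le_trans ?_ (mul_le_mul_of_nonneg_right hexp
      (integral_nonneg fun n => lastArmProb_nonneg _ _ _))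
    refine ((hkey .reference).2.trans_le ?_).trans_eq
      (congrArg (Real.exp (gam T * (Nat.log 2 T + 1)) * ·) (hkey .decoy).2.symm)
    rw [← tsum_mul_left]
    exact (hkey .reference).1.tsum_le_tsum
      (fun m => sum_reference_le_sum_decoy (gam_pos hT).le h A m) ((hkey .decoy).1.mul_left _)
  linarith

/-! ### The second moment of the walk -/

theorem geomWeight_eq_pow {γ : ℝ} (n : ℕ) : geomWeight γ n =
    (1 - Real.exp (-γ)) / (1 + Real.exp (-γ)) * Real.exp (-γ) ^ n := by
  rw [geomWeight, ← Real.exp_nat_mul]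
  congr 2
  simp
  ring

theorem geomWeight_neg (γ : ℝ) (n : ℤ) : geomWeight γ (-n) = geomWeight γ n := by
  simp [geomWeight]

/-- Uses `n² = 2 C(n+2, 2) - 3 C(n+1, 1) + 1` and the negative binomial series. -/
theorem hasSum_sq_mul_geometric {q : ℝ} (hq : 0 ≤ q) (hq1 : q < 1) :
    HasSum (fun n : ℕ => (n : ℝ) ^ 2 * q ^ n) (q * (1 + q) / (1 - q) ^ 3) := by
  have hn : ‖q‖ < 1 := by rwa [Real.norm_of_nonneg hq]
  have h0 := hasSum_choose_mul_geometric_of_norm_lt_one 0 hn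
  have h1 := hasSum_choose_mul_geometric_of_norm_lt_one 1 hn
  have h2 := hasSum_choose_mul_geometric_of_norm_lt_one 2 hn
  have h := ((h2.mul_left 2).sub (h1.mul_left 3)).add h0
  have hq2 : (1 - q) ≠ 0 := by linarith
  have e : q * (1 + q) / (1 - q) ^ 3 = 2 * (1 / (1 - q) ^ (2 + 1)) -
      3 * (1 / (1 - q) ^ (1 + 1)) + 1 / (1 - q) ^ (0 + 1) := by
    field_simp
    ring
  rw [e]
  refine h.congr_fun fun n => ?_
  have : ((n + 2).choose 2 : ℝ) = (n + 2) * (n + 1) / 2 := by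
    rw [Nat.cast_choose_two]
    push_cast
    ring
  rw [this]
  simp
  ring

theorem hasSum_sq_geomWeight {γ : ℝ} (hγ : 0 < γ) :
    HasSum (fun n : ℤ => geomWeight γ n * (n : ℝ) ^ 2)
      (2 * Real.exp (-γ) / (1 - Real.exp (-γ)) ^ 2) := by
  have hq0 : 0 < Real.exp (-γ) := Real.exp_pos _
  have hq1 : Real.exp (-γ) < 1 := by rw [Real.exp_lt_one_iff]; linarith
  have h := (hasSum_sq_mul_geometric hq0.le hq1).mul_left
    ((1 - Real.exp (-γ)) / (1 + Real.exp (-γ)))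
  have hpos : HasSum (fun n : ℕ => geomWeight γ (n : ℤ) * ((n : ℤ) : ℝ) ^ 2)
      ((1 - Real.exp (-γ)) / (1 + Real.exp (-γ)) *
        (Real.exp (-γ) * (1 + Real.exp (-γ)) / (1 - Real.exp (-γ)) ^ 3)) := by
    refine h.congr_fun fun n => ?_
    rw [geomWeight_eq_pow]
    push_cast
    ring
  have hneg : HasSum (fun n : ℕ => geomWeight γ (-(n : ℤ)) * ((-(n : ℤ) : ℤ) : ℝ) ^ 2)
      ((1 - Real.exp (-γ)) / (1 + Real.exp (-γ)) *
        (Real.exp (-γ) * (1 + Real.exp (-γ)) / (1 - Real.exp (-γ)) ^ 3)) := by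
    refine hpos.congr_fun fun n => ?_
    rw [geomWeight_neg]
    push_cast
    ring
  -- The term at `0`, common to both halves, vanishes.
  have := HasSum.of_nat_of_neg (f := fun n : ℤ => geomWeight γ n * (n : ℝ) ^ 2) hpos hneg
  have h1 : 1 - Real.exp (-γ) ≠ 0 := by linarith
  have h2 : 1 + Real.exp (-γ) ≠ 0 := by linarith
  have e : 2 * Real.exp (-γ) / (1 - Real.exp (-γ)) ^ 2 =
      2 * ((1 - Real.exp (-γ)) / (1 + Real.exp (-γ)) *
        (Real.exp (-γ) * (1 + Real.exp (-γ)) / (1 - Real.exp (-γ)) ^ 3)) := by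
    field_simp
  rw [e, two_mul]
  simpa using this

/-- With `q = exp (-γ)`, `exp γ ≥ 1 + γ` gives `γ q ≤ 1 - q`, and `q ≥ 3/4` gives `2 q ≤ 3 q²`. -/
theorem two_mul_div_sq_le {γ : ℝ} (hγ : 0 < γ) (hγ1 : γ ≤ 1 / 4) :
    2 * Real.exp (-γ) / (1 - Real.exp (-γ)) ^ 2 ≤ 3 / γ ^ 2 := by
  have h1 := Real.add_one_le_exp γ
  have h2 := Real.add_one_le_exp (-γ)
  have h3 : Real.exp γ * Real.exp (-γ) = 1 := by rw [← Real.exp_add]; simp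
  have hq0 : 0 < Real.exp (-γ) := Real.exp_pos _
  set q := Real.exp (-γ)
  have h4 : γ * q ≤ 1 - q := by nlinarith
  have h5 : 0 < γ * q := by positivity
  rw [div_le_div_iff₀ (by nlinarith) (by positivity)]
  have h6 : (γ * q) ^ 2 ≤ (1 - q) ^ 2 := pow_le_pow_left₀ h5.le h4 2
  have h7 : 2 * q * γ ^ 2 ≤ 3 * (γ * q) ^ 2 := by
    have : 2 * (q * γ ^ 2) ≤ 3 * q * (q * γ ^ 2) :=
      mul_le_mul_of_nonneg_right (by linarith) (by positivity)
    nlinarith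
  linarith

theorem toReal_ofReal_geomWeight {γ : ℝ} (hγ : 0 < γ) (n : ℤ) :
    (ENNReal.ofReal (geomWeight γ n)).toReal = geomWeight γ n :=
  ENNReal.toReal_ofReal (geomWeight_nonneg hγ.le n)

theorem memLp_geomLaw {γ : ℝ} (hγ : 0 < γ) :
    MemLp (fun n : ℤ => (n : ℝ)) 2 (geomLaw γ) := by
  rw [memLp_two_iff_integrable_sq (measurable_of_countable _).aestronglyMeasurable]
  refine integrable_sum_dirac (fun _ => ENNReal.ofReal_ne_top) ?_
  simp only [toReal_ofReal_geomWeight hγ, norm_pow, Real.norm_eq_abs, sq_abs]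
  exact (hasSum_sq_geomWeight hγ).summable

theorem integral_sq_geomLaw {γ : ℝ} (hγ : 0 < γ) :
    ∫ n : ℤ, (n : ℝ) ^ 2 ∂geomLaw γ = 2 * Real.exp (-γ) / (1 - Real.exp (-γ)) ^ 2 := by
  have h := hasSum_sq_geomWeight hγ
  rw [geomLaw, integral_sum_dirac_eq_tsum]
  · simpa only [toReal_ofReal_geomWeight hγ, smul_eq_mul] using h.tsum_eq
  · exact fun _ => ENNReal.ofReal_ne_top
  · simp only [toReal_ofReal_geomWeight hγ, norm_pow, Real.norm_eq_abs, sq_abs]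
    exact h.summable

theorem integral_id_geomLaw {γ : ℝ} (hγ : 0 < γ) : ∫ n : ℤ, (n : ℝ) ∂geomLaw γ = 0 := by
  have := isProbabilityMeasure_geomLaw hγ
  rw [integral_countable ((memLp_geomLaw hγ).integrable (by norm_num))]
  have hodd : ∀ n : ℤ, (geomLaw γ).real {-n} • ((-n : ℤ) : ℝ) =
      -((geomLaw γ).real {n} • (n : ℝ)) := by
    intro n
    simp only [measureReal_def, geomLaw_singleton, geomWeight_neg, smul_eq_mul]
    push_cast
    ring
  have h := (Equiv.neg ℤ).tsum_eq fun n : ℤ => (geomLaw γ).real {n} • (n : ℝ)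
  simp only [Equiv.neg_apply, hodd, tsum_neg] at h
  linarith

open ProbabilityTheory in
-- The steps are independent and centred, so the second moment of the sum is the sum of the
-- variances.
theorem integral_sq_sum_le {T : ℕ} (hT : 2 ≤ T) (S : Finset ℕ) :
    MemLp (fun n : Fin T → ℤ => ∑ i : Fin T, if i.val ∈ S then (n i : ℝ) else 0) 2 (stepLaw T) ∧
    ∫ n : Fin T → ℤ, (∑ i : Fin T, if i.val ∈ S then (n i : ℝ) else 0) ^ 2 ∂stepLaw T ≤
      S.card * (3 / gam T ^ 2) := by
  have hγ := gam_pos hT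
  have := isProbabilityMeasure_geomLaw hγ
  have hμ := isProbabilityMeasure_stepLaw hT
  set X : Fin T → ℤ → ℝ := fun i n => if i.val ∈ S then (n : ℝ) else 0 with hX
  have hmem : ∀ i, MemLp (X i) 2 (geomLaw (gam T)) := by
    intro i
    by_cases hi : i.val ∈ S
    · simpa [hX, hi] using memLp_geomLaw hγ
    · simp [hX, hi]
  have hmem' : ∀ i, MemLp (fun n : Fin T → ℤ => X i (n i)) 2 (stepLaw T) := fun i =>
    (hmem i).comp_measurePreserving (measurePreserving_eval (fun _ => geomLaw (gam T)) i)
  have hsum : (fun n : Fin T → ℤ => ∑ i : Fin T, if i.val ∈ S then (n i : ℝ) else 0) =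
      ∑ i, fun n : Fin T → ℤ => X i (n i) := by
    funext n
    simp [hX]
  have hmemsum : MemLp (∑ i, fun n : Fin T → ℤ => X i (n i)) 2 (stepLaw T) :=
    memLp_finsetSum' _ fun i _ => hmem' i
  refine ⟨hsum ▸ hmemsum, ?_⟩
  have hmean : ∀ i, ∫ n, X i n ∂geomLaw (gam T) = 0 := by
    intro i
    by_cases hi : i.val ∈ S
    · simpa [hX, hi] using integral_id_geomLaw hγ
    · simp [hX, hi]
  have hzero : ∫ n, (∑ i, fun n : Fin T → ℤ => X i (n i)) n ∂stepLaw T = 0 := by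
    simp only [Finset.sum_apply]
    rw [integral_finsetSum _ fun i _ => (hmem' i).integrable (by norm_num)]
    refine Finset.sum_eq_zero fun i _ => ?_
    rw [stepLaw, integral_comp_eval (hmem i).aestronglyMeasurable, hmean]
  have hvar := variance_of_integral_eq_zero hmemsum.aestronglyMeasurable.aemeasurable hzero
  have hvar' : Var[∑ i, fun n : Fin T → ℤ => X i (n i); stepLaw T] =
    ∑ i, Var[X i; geomLaw (gam T)] := variance_sum_pi hmem
  have e : ∫ n : Fin T → ℤ, (∑ i : Fin T, if i.val ∈ S then (n i : ℝ) else 0) ^ 2 ∂stepLaw T =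
      ∑ i, Var[X i; geomLaw (gam T)] := by
    rw [← hvar', hvar]
    refine integral_congr_ae (ae_of_all _ fun n => ?_)
    simp [hX]
  have hγ1 : gam T ≤ 1 / 4 := by
    have := one_le_logb hT
    rw [gam]
    exact one_div_le_one_div_of_le (by norm_num) (by linarith)
  have hone : ∀ i : Fin T, Var[X i; geomLaw (gam T)] ≤
      if i.val ∈ S then 3 / gam T ^ 2 else 0 := by
    intro i
    rw [variance_of_integral_eq_zero (hmem i).aestronglyMeasurable.aemeasurable (hmean i)]
    by_cases hi : i.val ∈ S
    · simp only [hX, hi, if_true]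
      exact (integral_sq_geomLaw hγ).trans_le (two_mul_div_sq_le hγ hγ1)
    · simp [hX, hi]
  rw [e]
  refine (Finset.sum_le_sum fun i _ => hone i).trans ?_
  rw [← Finset.sum_filter, Finset.sum_const, nsmul_eq_mul]
  refine mul_le_mul_of_nonneg_right ?_ (by positivity)
  exact_mod_cast Finset.card_le_card_of_injOn (fun i : Fin T => i.val)
    (fun i hi => (Finset.mem_filter.1 hi).2) (Fin.val_injective.injOn)

theorem epsilon_pos {T : ℕ} (hT : 2 ≤ T) : 0 < epsilon T := by
  have := one_le_logb hT
  unfold epsilon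
  positivity

theorem epsilon_sq {T : ℕ} (hT : 2 ≤ T) :
    epsilon T ^ 2 = 1 / (320 ^ 2 * Real.logb 2 T ^ 3) := by
  have h := one_le_logb hT
  have e : (Real.logb 2 T ^ (3 / 2 : ℝ)) ^ 2 = Real.logb 2 T ^ 3 := by
    rw [← Real.rpow_natCast, ← Real.rpow_mul (by linarith)]
    norm_num
  rw [epsilon, div_pow, mul_pow, e, one_pow]

/-- The walk has a small second moment. -/
theorem integral_walk_sq_le {T u : ℕ} (hT : 2 ≤ T) (hu : 0 < u) (huT : u ≤ T) :
    Integrable (fun n => walk T n u ^ 2) (stepLaw T) ∧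
    ∫ n, walk T n u ^ 2 ∂stepLaw T ≤ 1 / 1000 := by
  obtain ⟨S, hS, hcard, hsum⟩ := exists_mrw_eq_sum u
  have hSL : (S.card : ℝ) ≤ 2 * Real.logb 2 T := by
    refine le_trans ?_ (natLog_add_one_le hT)
    have h1 := hcard hu
    have h2 : Nat.log 2 u ≤ Nat.log 2 T := Nat.log_mono_right huT
    exact_mod_cast (by omega : S.card ≤ Nat.log 2 T + 1)
  have hw : ∀ n : Fin T → ℤ, walk T n u =
      epsilon T * ∑ i : Fin T, if i.val ∈ S then (n i : ℝ) else 0 := by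
    intro n
    rw [walk, hsum, Finset.mul_sum]
    have hsub : S ⊆ Finset.range T := hS.trans (Finset.range_mono huT)
    rw [Finset.sum_subset_zero_on_sdiff (s₁ := S) (s₂ := Finset.range T)
      (g := fun i => if i ∈ S then (if h : i < T then epsilon T * (n ⟨i, h⟩ : ℝ) else 0) else 0)
      hsub (fun i hi => if_neg (Finset.mem_sdiff.1 hi).2) (fun i hi => (if_pos hi).symm),
      ← Fin.sum_univ_eq_sum_range]
    refine Finset.sum_congr rfl fun i _ => ?_
    simp
  obtain ⟨h1, h2⟩ := integral_sq_sum_le hT S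
  simp only [hw, mul_pow]
  refine ⟨h1.integrable_sq.const_mul _, ?_⟩
  rw [integral_const_mul, epsilon_sq hT]
  have hL := one_le_logb hT
  refine (mul_le_mul_of_nonneg_left (h2.trans (mul_le_mul_of_nonneg_right hSL (by positivity)))
    (by positivity)).trans ?_
  rw [gam]
  have : Real.logb 2 T ≠ 0 := by positivity
  -- The powers of `log₂ T` cancel, leaving `2 * 3 * 16 / 320² = 96 / 102400`.
  field_simp
  norm_num

/-! ### The regret -/

theorem clip_mem (a : ℝ) : clip a ∈ Set.Icc (0 : ℝ) 1 :=
  ⟨le_min (le_max_right _ _) zero_le_one, min_le_right _ _⟩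

theorem clip_mono {a b : ℝ} (h : a ≤ b) : clip a ≤ clip b :=
  min_le_min_right _ (max_le_max_right _ h)

theorem walkReward_mem (T : ℕ) (n : Fin T → ℤ) (t : Fin T) (i : Arm) :
    walkReward T n t i ∈ Set.Icc (0 : ℝ) 1 := clip_mem _

/-- If `|w| ≤ 1/2 - e`, nothing is clipped and the gap is `e`. Otherwise `|w| > 0.49`, so `5 w² > 1`
and the left side is nonpositive. -/
theorem le_clip_sub_clip {w e : ℝ} (he : 0 ≤ e) (he1 : e ≤ 1 / 320) :
    e * (1 - 5 * w ^ 2) ≤ clip (1 / 2 + w) - clip (1 / 2 + w - e) := by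
  by_cases hw : |w| ≤ 1 / 2 - e
  · have := abs_le.1 hw
    have h : ∀ a : ℝ, 0 ≤ a → a ≤ 1 → clip a = a := fun a h0 h1 => by
      rw [clip, max_eq_left h0, min_eq_left h1]
    rw [h _ (by linarith) (by linarith), h _ (by linarith) (by linarith)]
    nlinarith [sq_nonneg w]
  · have h1 : clip (1 / 2 + w - e) ≤ clip (1 / 2 + w) := clip_mono (by linarith)
    have h2 : (49 / 100) ^ 2 ≤ |w| ^ 2 := pow_le_pow_left₀ (by norm_num) (by linarith) 2
    rw [sq_abs] at h2
    nlinarith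

/-- The regret is the sum of the expected losses against the reference arm. -/
theorem expectedRegret_eq {p : ℝ} (hp : 0 ≤ p) {T : ℕ} (A : Player T) (r : Fin T → Arm → ℝ) :
    expectedRegret p A r =
      ∑ t : Fin T, ∑ x, pathProb p A r x * (r t .reference - r t (x t.succ)) := by
  rw [Finset.sum_comm]
  simp only [mul_sub, Finset.sum_sub_distrib, ← Finset.mul_sum]
  rw [← Finset.sum_mul, sum_pathProb hp, one_mul]
  rfl

theorem abs_expectedRegret_le {T : ℕ} (A : Player T) {r : Fin T → Arm → ℝ}
    (hr : ∀ t i, r t i ∈ Set.Icc (0 : ℝ) 1) : |expectedRegret (1 / 2) A r| ≤ T := by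
  rw [expectedRegret_eq (by norm_num)]
  have h : ∀ t : Fin T,
      |∑ x, pathProb (1 / 2) A r x * (r t .reference - r t (x t.succ))| ≤ 1 := by
    intro t
    refine (Finset.abs_sum_le_sum_abs _ _).trans ?_
    refine le_of_le_of_eq ?_ (sum_pathProb (p := 1 / 2) (by norm_num) A r)
    refine Finset.sum_le_sum fun x _ => ?_
    have hx := pathProb_nonneg (p := 1 / 2) (by norm_num) (by norm_num) A r x
    rw [abs_mul, abs_of_nonneg hx]
    refine mul_le_of_le_one_right hx (abs_le.2 ⟨?_, ?_⟩) <;>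
      linarith [(hr t .reference).1, (hr t .reference).2, (hr t (x t.succ)).1,
        (hr t (x t.succ)).2]
  refine (Finset.abs_sum_le_sum_abs _ _).trans ((Finset.sum_le_sum fun t _ => h t).trans ?_)
  simp

theorem epsilon_le {T : ℕ} (hT : 2 ≤ T) : epsilon T ≤ 1 / 320 := by
  have : 1 ≤ Real.logb 2 T ^ (3 / 2 : ℝ) := Real.one_le_rpow (one_le_logb hT) (by norm_num)
  unfold epsilon
  exact one_div_le_one_div_of_le (by norm_num) (by linarith)

theorem le_expectedRegret_walkReward {T : ℕ} (hT : 2 ≤ T) (A : Player T) (n : Fin T → ℤ) :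
    ∑ t : Fin T, epsilon T *
      (lastArmProb (A.take (Nat.succ_le_of_lt t.isLt))
        (fun s => walkReward T n (s.castLE (Nat.succ_le_of_lt t.isLt))) .decoy -
        5 * walk T n (t.val + 1) ^ 2) ≤
      expectedRegret (1 / 2) A (walkReward T n) := by
  rw [expectedRegret_eq (by norm_num)]
  refine Finset.sum_le_sum fun t _ => ?_
  have h := sum_pathProb_take (1 / 2) (Nat.succ_le_of_lt t.isLt) A (walkReward T n)
    (fun y => if y (Fin.last _) = .decoy then 1 else 0)
  simp only [mul_ite, mul_one, mul_zero] at h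
  set q := lastArmProb (A.take (Nat.succ_le_of_lt t.isLt))
    (fun s => walkReward T n (s.castLE (Nat.succ_le_of_lt t.isLt))) .decoy with hq
  have hq' : q = ∑ x : Fin (T + 1) → Arm,
      if x t.succ = .decoy then pathProb (1 / 2) A (walkReward T n) x else 0 := h.symm
  have hq1 : q ≤ 1 := lastArmProb_le_one _ _
  have hq0 : 0 ≤ q := lastArmProb_nonneg _ _ _
  have hsum : ∑ x, pathProb (1 / 2) A (walkReward T n) x *
      (walkReward T n t .reference - walkReward T n t (x t.succ)) =
      q * (clip (1 / 2 + walk T n (t.val + 1)) -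
        clip (1 / 2 + walk T n (t.val + 1) - epsilon T)) := by
    rw [hq', Finset.sum_mul]
    refine Finset.sum_congr rfl fun x _ => ?_
    rcases x t.succ with _ | _ <;> simp [walkReward]
  rw [hsum]
  have hε := epsilon_pos hT
  refine le_trans ?_ (mul_le_mul_of_nonneg_left (le_clip_sub_clip hε.le (epsilon_le hT)) hq0)
  -- Since `q ≤ 1`, the clipping loss `5 q w²` is at most `5 w²`, so the walk can be integrated
  -- separately from the player.
  have : 0 ≤ epsilon T * (1 - q) * walk T n (t.val + 1) ^ 2 :=
    mul_nonneg (mul_nonneg hε.le (by linarith)) (sq_nonneg _)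
  nlinarith

theorem integrable_expectedRegret {T : ℕ} (hT : 2 ≤ T) (A : Player T) :
    Integrable (fun n => expectedRegret (1 / 2) A (walkReward T n)) (stepLaw T) :=
  integrable_stepLaw hT fun n => abs_expectedRegret_le A (walkReward_mem T n)

/-- The regret of a deterministic player against the clipped multi-scale random walk. -/
theorem le_integral_expectedRegret {T : ℕ} (hT : 2 ≤ T) (A : Player T) :
    (10 : ℝ) ^ (-4 : ℤ) * (T / Real.logb 2 T ^ (3 / 2 : ℝ)) ≤
      ∫ n, expectedRegret (1 / 2) A (walkReward T n) ∂(stepLaw T) := by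
  have hε := epsilon_pos hT
  have hq : ∀ t : Fin T, Integrable (fun n => lastArmProb (A.take (Nat.succ_le_of_lt t.isLt))
        (fun s => walkReward T n (s.castLE (Nat.succ_le_of_lt t.isLt))) .decoy) (stepLaw T) :=
    fun t => integrable_stepLaw hT (C := 1) fun n => by
      rw [abs_of_nonneg (lastArmProb_nonneg _ _ _)]
      exact lastArmProb_le_one _ _
  have hw := fun t : Fin T => integral_walk_sq_le hT (Nat.succ_pos t.val) t.isLt
  have hi : ∀ t : Fin T, Integrable (fun n => epsilon T *
      (lastArmProb (A.take (Nat.succ_le_of_lt t.isLt))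
        (fun s => walkReward T n (s.castLE (Nat.succ_le_of_lt t.isLt))) .decoy -
        5 * walk T n (t.val + 1) ^ 2)) (stepLaw T) := fun t =>
    ((hq t).sub ((hw t).1.const_mul 5)).const_mul (epsilon T)
  refine le_trans ?_ (integral_mono (integrable_finsetSum _ fun t _ => hi t)
    (integrable_expectedRegret hT A) (le_expectedRegret_walkReward hT A))
  rw [integral_finsetSum _ fun t _ => hi t]
  -- `1/3 - 5/1000 ≥ 1/4`; the resulting constant `1 / (320 * 4) = 1/1280` exceeds `10⁻⁴`.
  have hterm : ∀ t : Fin T, epsilon T * (1 / 4) ≤ ∫ n, epsilon T *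
      (lastArmProb (A.take (Nat.succ_le_of_lt t.isLt))
        (fun s => walkReward T n (s.castLE (Nat.succ_le_of_lt t.isLt))) .decoy -
        5 * walk T n (t.val + 1) ^ 2) ∂stepLaw T := by
    intro t
    rw [integral_const_mul, integral_sub (hq t) ((hw t).1.const_mul 5), integral_const_mul]
    refine mul_le_mul_of_nonneg_left ?_ hε.le
    have h1 := third_le_integral_lastArmProb hT (Nat.succ_le_of_lt t.isLt)
      (A.take (Nat.succ_le_of_lt t.isLt))
    have h2 := (hw t).2
    simp only [Nat.succ_eq_add_one] at h1 h2 ⊢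
    linarith
  refine le_trans ?_ (Finset.sum_le_sum fun t _ => hterm t)
  rw [Finset.sum_const, Finset.card_univ, Fintype.card_fin, nsmul_eq_mul, epsilon]
  have hL := one_le_logb hT
  have hL' : 0 < Real.logb 2 T ^ (3 / 2 : ℝ) := by positivity
  rw [show (T : ℝ) * (1 / (320 * Real.logb 2 T ^ (3 / 2 : ℝ)) * (1 / 4)) =
    (1 / 1280) * (T / Real.logb 2 T ^ (3 / 2 : ℝ)) by field_simp; norm_num]
  refine mul_le_mul_of_nonneg_right (by norm_num) (by positivity)

/-! ### Randomized players -/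

theorem measurable_expectedRegret {T : ℕ} {Ω : Type*} [MeasurableSpace Ω] {A : Ω → Player T}
    (hA : ∀ (t : Fin T) (h : Fin t.val → ℝ), MeasurableSet {ω | A ω t h = Move.switch})
    (p : ℝ) (r : Fin T → Arm → ℝ) : Measurable fun ω => expectedRegret p (A ω) r := by
  unfold expectedRegret pathProb
  refine measurable_const.sub (Finset.measurable_sum _ fun x _ => Measurable.mul_const
    (measurable_const.mul (Finset.measurable_prod _ fun t _ => ?_)) _)
  have e : (fun ω => transProb p (A ω t (observed r x t)) (x t.castSucc) (x t.succ)) =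
      fun ω => if A ω t (observed r x t) = Move.switch then
        transProb p .switch (x t.castSucc) (x t.succ) else
        transProb p .stay (x t.castSucc) (x t.succ) := by
    funext ω
    rcases A ω t (observed r x t) with _ | _ <;> simp
  rw [e]
  exact Measurable.ite (hA t _) measurable_const measurable_const

/-- The bound holds for each realization of the player, hence on average over both; by Fubini some
realization of the walk attains at least the average. -/
theorem exists_walkReward_le_integral {T : ℕ} (hT : 2 ≤ T) {Ω : Type*} [MeasurableSpace Ω]
    (μ : Measure Ω) [IsProbabilityMeasure μ] (A : Ω → Player T)
    (hA : ∀ (t : Fin T) (h : Fin t.val → ℝ), MeasurableSet {ω | A ω t h = Move.switch}) :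
    ∃ n : Fin T → ℤ, (10 : ℝ) ^ (-4 : ℤ) * (T / Real.logb 2 T ^ (3 / 2 : ℝ)) ≤
      ∫ ω, expectedRegret (1 / 2) (A ω) (walkReward T n) ∂μ := by
  have := isProbabilityMeasure_stepLaw hT
  have hint : Integrable (Function.uncurry fun (n : Fin T → ℤ) (ω : Ω) =>
      expectedRegret (1 / 2) (A ω) (walkReward T n)) ((stepLaw T).prod μ) := by
    refine Integrable.of_bound (Measurable.aestronglyMeasurable ?_) T
      (ae_of_all _ fun z => abs_expectedRegret_le _ (walkReward_mem T z.1))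
    exact measurable_from_prod_countable_right fun n =>
      measurable_expectedRegret hA (1 / 2) (walkReward T n)
  obtain ⟨n, hn⟩ := exists_integral_le hint.integral_prod_left
  refine ⟨n, le_trans ?_ hn⟩
  have hswap := integral_integral_swap hint
  refine le_of_le_of_eq ?_ hswap.symm
  have hmono := integral_mono (μ := μ) (integrable_const _) hint.integral_prod_right
    fun ω => le_integral_expectedRegret hT (A ω)
  simpa using hmono

end HiddenBandit

theorem theorem4 :
    -- every randomized player suffers large regret on some oblivious reward sequence
    (∃ c : ℝ, 0 < c ∧
      ∀ T : ℕ, 2 ≤ T →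
      ∀ (Ω : Type*) [MeasurableSpace Ω] (μ : Measure Ω) [IsProbabilityMeasure μ]
        (A : Ω → Player T),
        (∀ (t : Fin T) (h : Fin t.val → ℝ), MeasurableSet {ω | A ω t h = Move.switch}) →
        ∃ r : Fin T → Arm → ℝ, (∀ t i, r t i ∈ Set.Icc (0 : ℝ) 1) ∧
          c * (T / Real.logb 2 T ^ (3 / 2 : ℝ)) ≤ ∫ ω, expectedRegret (1 / 2) (A ω) r ∂μ) ∧
    -- every deterministic player suffers large regret on the clipped multi-scale random walk
    (∀ T : ℕ, 2 ≤ T → ∀ A : Player T,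
      (10 : ℝ) ^ (-4 : ℤ) * (T / Real.logb 2 T ^ (3 / 2 : ℝ)) ≤
        ∫ n, expectedRegret (1 / 2) A (walkReward T n) ∂(stepLaw T)) := by
  refine ⟨⟨(10 : ℝ) ^ (-4 : ℤ), by norm_num, fun T hT Ω _ μ _ A hA => ?_⟩,
    fun T hT A => le_integral_expectedRegret hT A⟩
  obtain ⟨n, hn⟩ := exists_walkReward_le_integral hT μ A hA
  exact ⟨walkReward T n, walkReward_mem T n, hn⟩
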